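/- Let $q$ be a prime power, let $\mathbb{P}^2$ be the projective plane over $\mathbb{F}_{q^2}$ with coordinates $(x:y:z)$, and let $X\subseteq\mathbb{P}^2$ be the Hermitian curve $y^qz+yz^q=x^{q+1}$. For an integer $d>0$, an effective divisor $E$ on $X$ supported at rational points, and a set $B\subseteq X(\mathbb{F}_{q^2})$ disjoint from the support of $E$, let $\mathcal{C}(B,d,-E)\subseteq\mathbb{F}_{q^2}^{|B|}$ be the code obtained by evaluating $H^0(X,\mathcal{O}_X(d)(-E))$ at (fixed homogeneous coordinates of) the points of $B$. Two codes $\mathcal{C},\mathcal{D}\subseteq\mathbb{F}_{q^2}^n$ are strongly isometric if the codewords of $\mathcal{C}$ are obtained by multiplying the codewords of $\mathcal{D}$ componentwise by one fixed vector with all components non-zero. Fix integers $d>0$, $s\ge 1$ and $a_1\le\cdots\le a_s$ in $\{1,\dots,q+1\}$. Let $r$ be the maximal $i\in\{1,\dots,s\}$ such that $a_i\le d-s+i$ (with $r=0$ if there is no such $i$), put $d'=d-s+r$ and assume $d'>0$. Let $P_1,\dots,P_s\in X(\mathbb{F}_{q^2})$ be distinct points, $E=\sum_{i=1}^s a_iP_i$,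 $E'=\sum_{i=1}^r a_iP_i$, and let $B\subseteq X(\mathbb{F}_{q^2})\setminus\{P_1,\dots,P_s\}$. Let $L$ be the product, over $r<i\le s$, of linear forms defining the tangent lines to $X$ at $P_i$ (so $L=1$ if $r=s$). Then multiplication by $L$ is a bijection $H^0(X,\mathcal{O}_X(d')(-E'))\to H^0(X,\mathcal{O}_X(d)(-E))$, whose inverse is the division by the equations of the tangent lines; $L$ vanishes at no point of $B$; and $\mathcal{C}(B,d,-E)$ is obtained from $\mathcal{C}(B,d',-E')$ by multiplying its codewords componentwise by the vector $(L(Q))_{Q\in B}$. In particular $\mathcal{C}(B,d,-E)$ and $\mathcal{C}(B,d',-E')$ are strongly isometric, and so are their dual codes. -/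

import Mathlib

/-! Evaluation codes on the Hermitian curve over the field with `q ^ 2` elements. -/

noncomputable section

namespace HermitianCode

open MvPolynomial

/-! ### Linear codes -/

section Codes

variable {F ι : Type*} [Field F]

/-- Two linear codes in `F ^ ι` are strongly isometric if the codewords of the first are obtained
by multiplying the codewords of the second, coordinatewise, by a vector all of whose components
are non-zero. -/
def StronglyIsometric (C D : Submodule F (ι → F)) : Prop :=
  ∃ w : ι → F, (∀ i, w i ≠ 0) ∧ (C : Set (ι → F)) = (fun c : ι → F => w * c) '' (D : Set (ι → F))

/-- The dual code with respect to the product `u · v = ∑ i, u i * v i`. -/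
def dualCode [Fintype ι] (C : Submodule F (ι → F)) : Submodule F (ι → F) where
  carrier := {u | ∀ v ∈ C, u ⬝ᵥ v = 0}
  zero_mem' := by intro v _; simp
  add_mem' := by
    intro a b ha hb v hv
    rw [add_dotProduct, ha v hv, hb v hv, add_zero]
  smul_mem' := by
    intro c a ha v hv
    rw [smul_dotProduct, ha v hv, smul_zero]

end Codes

/-! ### The Hermitian curve -/

variable (q : ℕ) (F : Type*) [Field F]

/-- The homogeneous equation `y ^ q z + y z ^ q - x ^ (q + 1)` of the Hermitian curve `X`, in the
coordinates `(x : y : z) = (X 0 : X 1 : X 2)`; its affine equation is `y ^ q + y = x ^ (q + 1)`. -/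
def hermitianPoly : MvPolynomial (Fin 3) F :=
  X 1 ^ q * X 2 + X 1 * X 2 ^ q - X 0 ^ (q + 1)

/-- The set `X(F)` of `F`-rational points of the Hermitian curve. -/
def Point : Type _ :=
  {P : Projectivization F (Fin 3 → F) // eval P.rep (hermitianPoly q F) = 0}

/-- The homogeneous coordinate ring `F[x, y, z] / (y ^ q z + y z ^ q - x ^ (q + 1))` of `X`. -/
abbrev CoordRing : Type _ :=
  MvPolynomial (Fin 3) F ⧸ Ideal.span {hermitianPoly q F}

variable {F}

/-- The class in the homogeneous coordinate ring of a polynomial. -/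
abbrev cls (f : MvPolynomial (Fin 3) F) : CoordRing q F :=
  Ideal.Quotient.mk (Ideal.span {hermitianPoly q F}) f

variable (F)

/-- The coordinate functions `x, y, z` in the homogeneous coordinate ring of `X`. -/
abbrev coord (i : Fin 3) : CoordRing q F := cls q (X i)

/-- The homogeneous part of degree `k` of the homogeneous coordinate ring of `X`. -/
def homogPart (k : ℕ) : Submodule F (CoordRing q F) :=
  (homogeneousSubmodule (Fin 3) F k).map
    (Ideal.Quotient.mkₐ F (Ideal.span {hermitianPoly q F})).toLinearMap

/-- The product, over the standard affine charts `x ≠ 0`, `y ≠ 0`, `z ≠ 0` of `X`, of the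
localizations of the homogeneous coordinate ring (the 0-cochains of the Čech complex of
`⨁ d, 𝒪_X(d)`). -/
abbrev Cochain : Type _ := ∀ i : Fin 3, Localization.Away (coord q F i)

variable {F} {q}

/-- The cochain given by an element of the homogeneous coordinate ring. -/
def toCochain : CoordRing q F →ₐ[F] Cochain q F :=
  AlgHom.pi fun i => IsScalarTower.toAlgHom F (CoordRing q F) (Localization.Away (coord q F i))

lemma toCochain_apply (f : CoordRing q F) (i : Fin 3) :
    toCochain f i = algebraMap (CoordRing q F) (Localization.Away (coord q F i)) f := rfl

namespace Point

/-- Homogeneous coordinates of a rational point of `X` (a fixed choice). -/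
def vec (P : Point q F) : Fin 3 → F := P.1.rep

lemma exists_vec_ne_zero (P : Point q F) : ∃ i, P.vec i ≠ 0 :=
  Function.ne_iff.mp P.1.rep_nonzero

/-- The evaluation of elements of the homogeneous coordinate ring at the coordinates of `P`. -/
def evalHom (P : Point q F) : CoordRing q F →ₐ[F] F :=
  Ideal.Quotient.liftₐ (Ideal.span {hermitianPoly q F}) (aeval P.vec) (by
    intro a ha
    obtain ⟨b, rfl⟩ := Ideal.mem_span_singleton.mp ha
    have h : eval P.vec (hermitianPoly q F) = 0 := P.2
    rw [map_mul, aeval_eq_eval, h, zero_mul])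

lemma evalHom_cls (P : Point q F) (f : MvPolynomial (Fin 3) F) :
    P.evalHom (cls q f) = eval P.vec f := by
  change aeval P.vec f = _
  rw [aeval_eq_eval]

/-- The homogeneous ideal of `P` in the homogeneous coordinate ring of `X`. -/
def ideal (P : Point q F) : Ideal (CoordRing q F) :=
  Ideal.span {g | (∃ k, g ∈ homogPart q F k) ∧ P.evalHom g = 0}

/-- The evaluation at `P` in the affine chart of index `i`, if it contains `P`. -/
def chartEval (P : Point q F) (i : Fin 3) (hi : P.vec i ≠ 0) :
    Localization.Away (coord q F i) →ₐ[F] F :=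
  IsLocalization.liftAlgHom (M := Submonoid.powers (coord q F i)) (f := P.evalHom) (by
    rintro ⟨_, n, rfl⟩
    change IsUnit (P.evalHom (coord q F i ^ n))
    rw [map_pow, evalHom_cls, eval_X]
    exact (IsUnit.mk0 _ hi).pow n)

lemma chartEval_toCochain (P : Point q F) (i : Fin 3) (hi : P.vec i ≠ 0) (g : CoordRing q F) :
    P.chartEval i hi (toCochain g i) = P.evalHom g := by
  rw [toCochain_apply]
  exact IsLocalization.lift_eq _ g

/-- The evaluation at `P`, through some affine chart that contains `P`.  On global sections of
`𝒪_X(d)` the choice of the chart is immaterial: see `evalAt_eq_chartEval`. -/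
def evalAt (P : Point q F) : Cochain q F →ₗ[F] F :=
  (P.chartEval P.exists_vec_ne_zero.choose P.exists_vec_ne_zero.choose_spec).toLinearMap ∘ₗ
    LinearMap.proj P.exists_vec_ne_zero.choose

/-- The form `∂h/∂x(P) x + ∂h/∂y(P) y + ∂h/∂z(P) z`, where `h` is the equation of `X`: the equation
of the tangent line `L_{X,P}` to `X` at `P`. -/
def tangentForm (P : Point q F) : MvPolynomial (Fin 3) F :=
  ∑ i, C (eval P.vec (pderiv i (hermitianPoly q F))) * X i

end Point

variable (q F)

/-- The space `H⁰(X, 𝒪_X(d))` of global sections, as the kernel of the Čech complex of `𝒪_X(d)`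
for the covering of `X` by the standard affine charts: in the `i`-th chart a section is a
quotient `f i / x_i ^ n` with `f i` homogeneous of degree `d + n`, and the quotients agree on
overlaps.  (The numerators and denominators may be multiplied by powers of the `x_i`; so one
exponent serves for all charts, and agreement on the overlaps holds after
cross-multiplication.) -/
def globalSections (d : ℕ) : Submodule F (Cochain q F) where
  carrier := {t | ∃ (n : ℕ) (f : Fin 3 → CoordRing q F),
    (∀ i, f i ∈ homogPart q F (d + n)) ∧
    (∀ i, (toCochain (coord q F i ^ n) * t) i = toCochain (f i) i) ∧
    (∀ i j, coord q F j ^ n * f i = coord q F i ^ n * f j)}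
  zero_mem' := ⟨0, 0, fun i => Submodule.zero_mem _, by simp, by simp⟩
  add_mem' := by
    rintro a b ⟨n, f, hf, hfa, hfc⟩ ⟨m, g, hg, hgb, hgc⟩
    have key : ∀ (i : Fin 3) (k e : ℕ) (u : CoordRing q F), u ∈ homogPart q F e →
        coord q F i ^ k * u ∈ homogPart q F (e + k) := by
      rintro i k e _ ⟨p, hp, rfl⟩
      refine ⟨X i ^ k * p, ?_, ?_⟩
      · have h1 : (X i ^ k : MvPolynomial (Fin 3) F).IsHomogeneous k := isHomogeneous_X_pow i k
        have := h1.mul hp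
        rwa [add_comm] at this
      · simp [coord, cls]
    refine ⟨n + m, fun i => coord q F i ^ m * f i + coord q F i ^ n * g i, ?_, ?_, ?_⟩
    · intro i
      refine Submodule.add_mem _ ?_ ?_
      · have := key i m _ _ (hf i)
        rwa [add_assoc] at this
      · have := key i n _ _ (hg i)
        rwa [add_assoc, add_comm m n] at this
    · intro i
      have h1 := hfa i
      have h2 := hgb i
      simp only [map_add, map_mul, map_pow, Pi.add_apply, Pi.mul_apply, Pi.pow_apply] at h1 h2 ⊢
      rw [← h1, ← h2]
      ring
    · intro i j
      linear_combination coord q F j ^ m * coord q F i ^ m * hfc i j +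
        coord q F j ^ n * coord q F i ^ n * hgc i j
  smul_mem' := by
    rintro c a ⟨n, f, hf, hfa, hfc⟩
    refine ⟨n, fun i => c • f i, fun i => Submodule.smul_mem _ _ (hf i), ?_, ?_⟩
    · intro i
      rw [mul_smul_comm, Pi.smul_apply, hfa, map_smul, Pi.smul_apply]
    · intro i j
      rw [mul_smul_comm, mul_smul_comm, hfc i j]

variable {q F}

/-- The value of a global section of `𝒪_X(d)` at `P` can be computed in any chart. -/
lemma evalAt_eq_chartEval {d : ℕ} {t : Cochain q F} (ht : t ∈ globalSections q F d)
    (P : Point q F) (i : Fin 3) (hi : P.vec i ≠ 0) : P.evalAt t = P.chartEval i hi (t i) := by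
  obtain ⟨n, f, -, hft, hfc⟩ := ht
  have key : ∀ (j : Fin 3) (hj : P.vec j ≠ 0),
      P.vec j ^ n * P.chartEval j hj (t j) = P.evalHom (f j) := by
    intro j hj
    have h := congrArg (P.chartEval j hj) (hft j)
    rw [Pi.mul_apply, map_mul, P.chartEval_toCochain, P.chartEval_toCochain, map_pow,
      Point.evalHom_cls, eval_X] at h
    exact h
  set j := P.exists_vec_ne_zero.choose with hjdef
  have hj : P.vec j ≠ 0 := P.exists_vec_ne_zero.choose_spec
  change P.chartEval j hj (t j) = _
  have h := congrArg P.evalHom (hfc i j)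
  simp only [map_mul, map_pow, Point.evalHom_cls, eval_X] at h
  rw [← key i hi, ← key j hj] at h
  have hne : P.vec i ^ n * P.vec j ^ n ≠ 0 := mul_ne_zero (pow_ne_zero n hi) (pow_ne_zero n hj)
  apply mul_left_cancel₀ hne
  linear_combination -h

/-- The space `H⁰(X, 𝒪_X(d)(-E))` for an effective divisor `E = ∑ E(P) P` supported at rational
points: the global sections of `𝒪_X(d)` whose germ at each point `P` lies in the `E(P)`-th power of
the maximal ideal, i.e. is of the form `f / g` with `f` in the `E(P)`-th power of the ideal of `P`
and `g` not vanishing at `P`. -/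
def sections (d : ℕ) (E : Point q F →₀ ℕ) : Submodule F (Cochain q F) where
  carrier := {t | t ∈ globalSections q F d ∧ ∀ P : Point q F, ∃ g f : CoordRing q F,
    P.evalHom g ≠ 0 ∧ f ∈ P.ideal ^ E P ∧ toCochain g * t = toCochain f}
  zero_mem' := ⟨Submodule.zero_mem _, fun P => ⟨1, 0, by simp, Submodule.zero_mem _, by simp⟩⟩
  add_mem' := by
    rintro a b ⟨ha, ha'⟩ ⟨hb, hb'⟩
    refine ⟨Submodule.add_mem _ ha hb, fun P => ?_⟩
    obtain ⟨g₁, f₁, hg₁, hf₁, h₁⟩ := ha' P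
    obtain ⟨g₂, f₂, hg₂, hf₂, h₂⟩ := hb' P
    refine ⟨g₁ * g₂, g₂ * f₁ + g₁ * f₂, ?_, ?_, ?_⟩
    · rw [map_mul]; exact mul_ne_zero hg₁ hg₂
    · exact Ideal.add_mem _ (Ideal.mul_mem_left _ _ hf₁) (Ideal.mul_mem_left _ _ hf₂)
    · rw [map_add, map_mul, map_mul, map_mul, ← h₁, ← h₂]
      ring
  smul_mem' := by
    rintro c a ⟨ha, ha'⟩
    refine ⟨Submodule.smul_mem _ _ ha, fun P => ?_⟩
    obtain ⟨g, f, hg, hf, h⟩ := ha' P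
    refine ⟨g, c • f, hg, Submodule.smul_of_tower_mem _ c hf, ?_⟩
    rw [mul_smul_comm, h, map_smul]

/-- The code `𝒞(B, d, -E)`: the evaluation of `H⁰(X, 𝒪_X(d)(-E))` at the points of `B`. -/
def code (B : Finset (Point q F)) (d : ℕ) (E : Point q F →₀ ℕ) : Submodule F (B → F) :=
  (sections d E).map (LinearMap.pi fun Q : B => Q.1.evalAt)

end HermitianCode

end

/-! ### The coordinate ring and global sections as forms -/

noncomputable section

namespace HermitianCode

open MvPolynomial

section Polynomials

variable {F σ : Type*} [Field F]

/-! The tangent line `T = 0` at a rational point `P` of the Hermitian curve meets it only at `P`,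
with multiplicity `q + 1`. This is read off an identity `h = T U + k l ^ (q + 1)`, with `k` and
`U(P)` non-zero and `l` a linear form independent of `T` with `l(P) = 0` (`exists_isTangentFrame`).

Let `f` be a form of degree `d` vanishing at `P` to order at least `a`, with `d < a ≤ q + 1`. On the
tangent line it becomes a polynomial of degree at most `d` divisible by the `a`-th power of a
parameter, hence zero, so `T ∣ f` (`tangentForm_dvd`). Conversely, a factor `T` contributes order `q
+ 1 ≥ a` at `P` and is a unit at every other rational point. Thus multiplication by `T` identifies
sections before and after adding `a P` to the divisor and 1 to the degree (`bijOn_sections`).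

By maximality of `r`, `a i > d - s + i` for `r < i ≤ s`, and `d - s + i` is exactly the degree
reached once the factors up to `i` are present; so the step iterates. Since `L` has no zero on `B`,
evaluation turns the bijection into a strong isometry. Working with forms is legitimate because
every global section of `𝒪_X(d)` is a form (`mem_globalSections_iff`). -/

lemma aeval_sub_aeval_mem {A : Type*} [CommRing A] [Algebra F A] (I : Ideal A) {f g : σ → A}
    (h : ∀ i, f i - g i ∈ I) (p : MvPolynomial σ F) : aeval f p - aeval g p ∈ I := by
  have hfg : (Ideal.Quotient.mkₐ F I).comp (aeval f) = (Ideal.Quotient.mkₐ F I).comp (aeval g) := by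
    ext i
    simpa [Ideal.Quotient.mk_eq_mk_iff_sub_mem] using h i
  exact Ideal.Quotient.mk_eq_mk_iff_sub_mem _ _ |>.mp (congrArg (fun φ => φ p) hfg)

attribute [local instance] MvPolynomial.gradedAlgebra

lemma homogeneousComponent_add_mul {f : MvPolynomial σ F} {k : ℕ} (hf : f.IsHomogeneous k)
    (d : ℕ) (g : MvPolynomial σ F) :
    homogeneousComponent (k + d) (f * g) = f * homogeneousComponent d g := by
  have := DirectSum.coe_decompose_mul_add_of_left_mem (homogeneousSubmodule σ F) (i := k) (j := d)
    (a := f) (b := g) hf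
  rw [← decomposition.decompose'_apply, ← decomposition.decompose'_apply]
  exact this

lemma homogeneousComponent_mem_span_singleton {f p : MvPolynomial σ F} {k : ℕ}
    (hf : f.IsHomogeneous k) (hp : p ∈ Ideal.span {f}) (d : ℕ) :
    homogeneousComponent d p ∈ Ideal.span {f} := by
  refine homogeneousComponent_mem_of_mem (Ideal.homogeneous_span _ _ ?_) hp d
  rintro _ rfl
  exact ⟨k, hf⟩

end Polynomials

variable {q : ℕ} {F : Type*} [Field F]

lemma isHomogeneous_hermitianPoly : (hermitianPoly q F).IsHomogeneous (q + 1) := by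
  refine ((((isHomogeneous_X_pow _ q).mul (isHomogeneous_X F _))).add ?_).sub
    (isHomogeneous_X_pow _ _)
  rw [add_comm q 1]
  exact (isHomogeneous_X F _).mul (isHomogeneous_X_pow _ _)

lemma cls_eq_cls_iff {f g : MvPolynomial (Fin 3) F} :
    cls q f = cls q g ↔ ∃ w, f = g + hermitianPoly q F * w := by
  rw [cls, cls, Ideal.Quotient.mk_eq_mk_iff_sub_mem, Ideal.mem_span_singleton]
  exact ⟨fun ⟨w, hw⟩ => ⟨w, by rw [← hw]; ring⟩, fun ⟨w, hw⟩ => ⟨w, by rw [hw]; ring⟩⟩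

lemma cls_eq_zero_iff {f : MvPolynomial (Fin 3) F} : cls q f = 0 ↔ hermitianPoly q F ∣ f := by
  rw [cls, Ideal.Quotient.eq_zero_iff_dvd]

lemma cls_mul (f g : MvPolynomial (Fin 3) F) : cls q (f * g) = cls q f * cls q g :=
  map_mul _ f g

lemma mem_homogPart_iff {k : ℕ} {g : CoordRing q F} :
    g ∈ homogPart q F k ↔ ∃ f : MvPolynomial (Fin 3) F, f.IsHomogeneous k ∧ cls q f = g :=
  Iff.rfl

/-- Division of homogeneous elements of the coordinate ring by homogeneous elements. -/
lemma mem_homogPart_of_mul_mem {f g : MvPolynomial (Fin 3) F} {k d : ℕ} (hf : f.IsHomogeneous k)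
    (hreg : ∀ u : CoordRing q F, cls q f * u = 0 → u = 0)
    (h : cls q f * cls q g ∈ homogPart q F (k + d)) : cls q g ∈ homogPart q F d := by
  obtain ⟨p, hp, hpe⟩ := mem_homogPart_iff.mp h
  refine mem_homogPart_iff.mpr ⟨homogeneousComponent d g, homogeneousComponent_isHomogeneous d g,
    sub_eq_zero.mp (hreg _ ?_)⟩
  -- The ideal of the curve is homogeneous, so the relation `f g ≡ p` may be replaced by its
  -- component of degree `k + d`.
  have h1 : f * g - p ∈ Ideal.span {hermitianPoly q F} := by
    rw [← Ideal.Quotient.eq_zero_iff_mem, map_sub, map_mul, sub_eq_zero]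
    exact hpe.symm
  have h2 := homogeneousComponent_mem_span_singleton isHomogeneous_hermitianPoly h1 (k + d)
  rw [map_sub, homogeneousComponent_add_mul hf, homogeneousComponent_eq_self hp,
    ← Ideal.Quotient.eq_zero_iff_mem, map_sub, map_mul, sub_eq_zero] at h2
  rw [mul_sub, sub_eq_zero, ← hpe]
  exact h2

lemma not_X_one_dvd_hermitianPoly (hq : 0 < q) : ¬ (X 1 ∣ hermitianPoly q F) := by
  rintro ⟨w, hw⟩
  have := congrArg (eval ![1, 0, 0]) hw
  simp [hermitianPoly, hq.ne'] at this

lemma eq_zero_of_coord_one_mul (hq : 0 < q) {u : CoordRing q F} (h : coord q F 1 * u = 0) :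
    u = 0 := by
  obtain ⟨g, rfl⟩ := Ideal.Quotient.mk_surjective u
  rw [coord, cls, ← map_mul] at h
  obtain ⟨w, hw⟩ := cls_eq_zero_iff.mp h
  have h1 : X 1 ∣ hermitianPoly q F * w := ⟨g, hw.symm⟩
  obtain ⟨v, rfl⟩ := ((X_prime (R := F) (i := (1 : Fin 3))).dvd_or_dvd h1).resolve_left
    (not_X_one_dvd_hermitianPoly hq)
  refine cls_eq_zero_iff.mpr ⟨v, mul_left_cancel₀ (X_ne_zero 1) ?_⟩
  rw [hw]; ring

lemma eq_zero_of_coord_one_pow_mul (hq : 0 < q) (n : ℕ) {u : CoordRing q F}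
    (h : coord q F 1 ^ n * u = 0) : u = 0 := by
  induction n with
  | zero => simpa using h
  | succ n ih => exact ih (eq_zero_of_coord_one_mul hq (by rw [← h]; ring))

lemma toCochain_injective (hq : 0 < q) :
    Function.Injective (toCochain : CoordRing q F → Cochain q F) := by
  rw [injective_iff_map_eq_zero]
  intro u hu
  have h1 : algebraMap (CoordRing q F) (Localization.Away (coord q F 1)) u = 0 := by
    rw [← toCochain_apply, hu, Pi.zero_apply]
  rw [IsLocalization.map_eq_zero_iff (Submonoid.powers (coord q F 1))] at h1
  obtain ⟨⟨_, n, rfl⟩, hn⟩ := h1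
  exact eq_zero_of_coord_one_pow_mul hq n hn

/-- Modulo the curve and `y ^ n`, `z` is a nonzerodivisor: setting `z = 0` turns `h` into `-x ^ (q +
1)`, which is prime to `y`. This regularity makes sections on the charts `y ≠ 0` and `z ≠ 0` glue to
a form. -/
lemma exists_of_X_two_mul_eq (hq : 0 < q) {n : ℕ} {f g w : MvPolynomial (Fin 3) F}
    (h : X 2 * f = X 1 ^ n * g + hermitianPoly q F * w) :
    ∃ g' w', f = X 1 ^ n * g' + hermitianPoly q F * w' := by
  set ρ : MvPolynomial (Fin 3) F →ₐ[F] MvPolynomial (Fin 3) F := aeval ![X 0, X 1, 0] with hρ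
  have hdvd : X 2 ∣ w - ρ w := by
    rw [← Ideal.mem_span_singleton]
    nth_rewrite 1 [← aeval_X_left_apply w]
    refine aeval_sub_aeval_mem _ (fun i => ?_) w
    rw [Ideal.mem_span_singleton]
    fin_cases i <;> simp
  have h1 := congrArg ρ h
  simp only [hermitianPoly, map_mul, map_add, map_sub, map_pow, hρ, aeval_X] at h1
  simp only [Matrix.cons_val, zero_mul, mul_zero, zero_pow hq.ne', add_zero, zero_sub] at h1
  rw [← hρ] at h1
  have h2 : X 1 ^ n ∣ X 0 ^ (q + 1) * ρ w := ⟨ρ g, by linear_combination h1⟩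
  have h3 : ¬ X 1 ∣ (X 0 ^ (q + 1) : MvPolynomial (Fin 3) F) := fun hd => by
    simpa using X_dvd_X.mp ((X_prime (R := F) (i := (1 : Fin 3))).dvd_of_dvd_pow hd)
  -- Together with `hdvd` this writes `w` as `y ^ n w' + z w''`; the first term is absorbed into
  -- `g`, the second into `f`.
  obtain ⟨w', hw'⟩ := X_prime.pow_dvd_of_dvd_mul_left n h3 h2
  obtain ⟨w'', hw''⟩ := hdvd
  have h4 : X 2 ∣ X 1 ^ n * (g + hermitianPoly q F * w') :=
    ⟨f - hermitianPoly q F * w'',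
      by linear_combination -h - hermitianPoly q F * hw'' - hermitianPoly q F * hw'⟩
  have h5 : ¬ X 2 ∣ (X 1 ^ n : MvPolynomial (Fin 3) F) := fun hd => by
    simpa using X_dvd_X.mp ((X_prime (R := F) (i := (2 : Fin 3))).dvd_of_dvd_pow hd)
  obtain ⟨g', hg'⟩ := (X_prime.dvd_or_dvd h4).resolve_left h5
  refine ⟨g', w'', mul_left_cancel₀ (X_ne_zero 2) ?_⟩
  linear_combination h + X 1 ^ n * hg' + hermitianPoly q F * hw'' + hermitianPoly q F * hw'

lemma exists_of_X_two_pow_mul_eq (hq : 0 < q) {n : ℕ} (m : ℕ) {f g w : MvPolynomial (Fin 3) F}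
    (h : X 2 ^ m * f = X 1 ^ n * g + hermitianPoly q F * w) :
    ∃ g' w', f = X 1 ^ n * g' + hermitianPoly q F * w' := by
  induction m generalizing g w with
  | zero => exact ⟨g, w, by simpa using h⟩
  | succ m ih =>
    obtain ⟨g', w', h'⟩ := exists_of_X_two_mul_eq hq (f := X 2 ^ m * f) (by rw [← h]; ring)
    exact ih h'

lemma exists_coord_one_pow_dvd (hq : 0 < q) {n m : ℕ} {u v : CoordRing q F}
    (h : coord q F 2 ^ m * u = coord q F 1 ^ n * v) : ∃ g, u = coord q F 1 ^ n * g := by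
  obtain ⟨f, rfl⟩ := Ideal.Quotient.mk_surjective u
  obtain ⟨g, rfl⟩ := Ideal.Quotient.mk_surjective v
  simp only [coord, cls, ← map_pow, ← map_mul] at h
  obtain ⟨w, hw⟩ := cls_eq_cls_iff.mp h
  obtain ⟨g', w', h'⟩ := exists_of_X_two_pow_mul_eq hq m hw
  refine ⟨cls q g', ?_⟩
  simp only [coord, cls, ← map_pow, ← map_mul]
  exact cls_eq_cls_iff.mpr ⟨w', h'⟩

lemma toCochain_mem_globalSections {d : ℕ} {g : CoordRing q F} (hg : g ∈ homogPart q F d) :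
    toCochain g ∈ globalSections q F d :=
  ⟨0, fun _ => g, by simpa using hg, by simp, by simp⟩

/-- The global sections of `𝒪_X(d)` are the forms of degree `d`. -/
lemma mem_globalSections_iff (hq : 0 < q) {d : ℕ} {t : Cochain q F} :
    t ∈ globalSections q F d ↔ ∃ g ∈ homogPart q F d, toCochain g = t := by
  refine ⟨?_, fun ⟨g, hg, h⟩ => h ▸ toCochain_mem_globalSections hg⟩
  rintro ⟨n, f, hf, hft, hfc⟩
  -- Two charts suffice to find `g`; the third follows by cancelling a power of `y`.
  obtain ⟨g, hg⟩ := exists_coord_one_pow_dvd hq (hfc 1 2)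
  have hfg : ∀ i, f i = coord q F i ^ n * g := fun i => by
    refine sub_eq_zero.mp (eq_zero_of_coord_one_pow_mul hq n ?_)
    rw [mul_sub, hfc i 1, hg]
    ring
  refine ⟨g, ?_, ?_⟩
  · obtain ⟨p, rfl⟩ := Ideal.Quotient.mk_surjective g
    have hX : cls q (X 1 ^ n : MvPolynomial (Fin 3) F) = coord q F 1 ^ n := map_pow _ _ _
    refine mem_homogPart_of_mul_mem (f := X 1 ^ n) (k := n) (isHomogeneous_X_pow _ _)
      (fun u hu => eq_zero_of_coord_one_pow_mul hq n (hX ▸ hu)) ?_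
    rw [hX, ← hg, add_comm]
    exact hf 1
  · funext i
    have h1 := hft i
    rw [hfg i, map_mul, Pi.mul_apply, Pi.mul_apply] at h1
    have hu : IsUnit (toCochain (coord q F i ^ n) i) := by
      rw [toCochain_apply]
      exact IsLocalization.map_units _ (⟨_, n, rfl⟩ : Submonoid.powers (coord q F i))
    exact (hu.mul_left_cancel h1).symm

/-- The sections of `𝒪_X(d)(-E)` are the forms of degree `d` vanishing along `E`. -/
lemma mem_sections_iff (hq : 0 < q) {d : ℕ} {E : Point q F →₀ ℕ} {t : Cochain q F} :
    t ∈ sections d E ↔ ∃ f : MvPolynomial (Fin 3) F, f.IsHomogeneous d ∧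
      (∀ P : Point q F, ∃ g : CoordRing q F, P.evalHom g ≠ 0 ∧ g * cls q f ∈ P.ideal ^ E P) ∧
      toCochain (cls q f) = t := by
  constructor
  · rintro ⟨ht, hE⟩
    obtain ⟨_, ⟨f, hf, rfl⟩, rfl⟩ := (mem_globalSections_iff hq).mp ht
    refine ⟨f, hf, fun P => ?_, rfl⟩
    obtain ⟨g, f', hg, hf', h⟩ := hE P
    refine ⟨g, hg, ?_⟩
    rw [← map_mul] at h
    exact (toCochain_injective hq h).symm ▸ hf'
  · rintro ⟨f, hf, hE, rfl⟩
    refine ⟨toCochain_mem_globalSections (mem_homogPart_iff.mpr ⟨f, hf, rfl⟩), fun P => ?_⟩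
    obtain ⟨g, hg, h⟩ := hE P
    exact ⟨g, _, hg, h, (map_mul _ _ _).symm⟩

end HermitianCode

end

/-! ### Coordinates adapted to a tangent line -/

noncomputable section

namespace HermitianCode

open MvPolynomial

variable {q : ℕ} {F : Type*} [Field F]

/-- Coordinates `n, l, T` adapted to the tangent line `T = 0` of `X` at `P`: they are dual to the
basis `P, v, w`, up to the normalization of `T`, and the equation of `X` is `T U + k l ^ (q + 1)`
with `U` not vanishing at `P`. -/
structure IsTangentFrame (P : Point q F) (n l U : MvPolynomial (Fin 3) F) (v w : Fin 3 → F)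
    (k : F) : Prop where
  isHomogeneous_l : l.IsHomogeneous 1
  X_eq : ∀ i, X i = C (P.vec i) * n + C (v i) * l + C (w i) * P.tangentForm
  hermitianPoly_eq : hermitianPoly q F = P.tangentForm * U + C k * l ^ (q + 1)
  k_ne_zero : k ≠ 0
  eval_U : eval P.vec U ≠ 0
  eval_l : eval P.vec l = 0
  eval_n_v : eval v n = 0
  eval_l_v : eval v l = 1
  eval_tangentForm : eval P.vec P.tangentForm = 0
  eval_tangentForm_v : eval v P.tangentForm = 0
  tangentForm_ne_zero : P.tangentForm ≠ 0

lemma tangentForm_eq (hq0 : (q : F) = 0) (P : Point q F) :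
    P.tangentForm = -C (P.vec 0 ^ q) * X 0 + C (P.vec 2 ^ q) * X 1 + C (P.vec 1 ^ q) * X 2 := by
  simp [Point.tangentForm, Fin.sum_univ_three, hermitianPoly, pderiv_X, Pi.single_apply, hq0,
    Derivation.leibniz, Derivation.leibniz_pow]

lemma eval_vec_hermitianPoly (P : Point q F) :
    P.vec 1 ^ q * P.vec 2 + P.vec 1 * P.vec 2 ^ q - P.vec 0 ^ (q + 1) = 0 := by
  have h : eval P.vec (hermitianPoly q F) = 0 := P.2
  simpa [hermitianPoly] using h

/-- The equation is a Hermitian form: since `c ^ (q ^ 2) = c`, the power `T ^ q` has the coordinates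
of `P` themselves as coefficients. This makes `h` split into a multiple of `T` and a power of a
linear form. -/
lemma exists_isTangentFrame (hq : 2 ≤ q) (hq0 : (q : F) = 0)
    (hadd : ∀ f g : MvPolynomial (Fin 3) F, (f + g) ^ q = f ^ q + g ^ q)
    (hpow : ∀ c : F, (c ^ q) ^ q = c) (P : Point q F) :
    ∃ n l U v w k, IsTangentFrame P n l U v w k := by
  have hT := tangentForm_eq hq0 P
  have hP := eval_vec_hermitianPoly P
  obtain ⟨i, hi⟩ := P.exists_vec_ne_zero
  generalize ha : P.vec 0 = a at *
  generalize hb : P.vec 1 = b at *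
  generalize hc : P.vec 2 = c at *
  have hqpos : q ≠ 0 := by omega
  have hTq : P.tangentForm * P.tangentForm ^ (q - 1) = P.tangentForm ^ q := mul_pow_sub_one hqpos _
  have hTP : eval P.vec P.tangentForm = 0 := by
    rw [hT]
    simp only [map_add, map_mul, map_neg, eval_C, eval_X, ha, hb, hc]
    linear_combination hP
  -- If `c = 0`, then `P = (0 : 1 : 0)`, the point at infinity, and `T` is proportional to `z`.
  by_cases hc0 : c = 0
  · subst hc0
    have ha0 : a = 0 := by simpa [hqpos] using hP
    subst ha0
    have hb0 : b ≠ 0 := by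
      rintro rfl
      fin_cases i <;> simp_all
    have hbC : (C b⁻¹ : MvPolynomial (Fin 3) F) * C b = 1 := by
      rw [← C_mul, inv_mul_cancel₀ hb0, C_1]
    have hT' : P.tangentForm = C b ^ q * X 2 := by rw [hT]; simp [hqpos]
    have hbq : (C b⁻¹ : MvPolynomial (Fin 3) F) ^ q * C b ^ q = 1 := by
      rw [← mul_pow, hbC, one_pow]
    refine ⟨C b⁻¹ * X 1, X 0, C b⁻¹ ^ q * (X 1 ^ q + X 1 * X 2 ^ (q - 1)), ![1, 0, 0],
      ![0, 0, b⁻¹ ^ q], -1, isHomogeneous_X _ _, ?_, ?_, by simp, ?_, by simp [ha], by simp,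
      by simp, hTP, ?_, ?_⟩
    · intro i
      match i with
      | 0 => simp [ha]
      | 1 =>
        simp only [hb, Matrix.cons_val, C_0]
        linear_combination -X 1 * hbC
      | 2 =>
        simp only [hc, hT', Matrix.cons_val, C_0, C_pow]
        linear_combination -X 2 * hbq
    · have h2 : (X 2 : MvPolynomial (Fin 3) F) * X 2 ^ (q - 1) = X 2 ^ q := mul_pow_sub_one hqpos _
      rw [hT', hermitianPoly, C_neg, C_1]
      linear_combination (-(X 2 * X 1 ^ q) - X 1 * X 2 ^ q) * hbq -
        C b ^ q * C b⁻¹ ^ q * X 1 * h2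
    -- `q ≥ 2` is needed here so that the term with exponent `q - 1` vanishes at `P`.
    · have : q - 1 ≠ 0 := by omega
      simp [hb, hc, this, hb0, hqpos]
    · rw [hT']; simp
    · rw [hT']
      exact mul_ne_zero (pow_ne_zero _ (C_ne_zero.mpr hb0)) (X_ne_zero 2)
  · have hcC : (C c⁻¹ : MvPolynomial (Fin 3) F) * C c = 1 := by
      rw [← C_mul, inv_mul_cancel₀ hc0, C_1]
    have hcC' : (C c⁻¹ : MvPolynomial (Fin 3) F) ^ q * C c ^ q = 1 := by
      rw [← mul_pow, hcC, one_pow]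
    have hPC : (C b ^ q * C c + C b * C c ^ q - C a ^ (q + 1) : MvPolynomial (Fin 3) F) = 0 := by
      simp only [← C_pow, ← C_mul, ← C_add, ← C_sub, hP, C_0]
    have hneg : ∀ f : MvPolynomial (Fin 3) F, (-f) ^ q = -f ^ q := fun f => by
      have := hadd f (-f)
      rw [add_neg_cancel, zero_pow hqpos] at this
      linear_combination -this
    have hTpow : P.tangentForm ^ q = -(C a * X 0 ^ q) + C c * X 1 ^ q + C b * X 2 ^ q := by
      rw [hT, hadd, hadd, neg_mul, hneg]
      simp only [mul_pow, ← C_pow, hpow]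
    have hlpow : (C c * X 0 - C a * X 2 : MvPolynomial (Fin 3) F) ^ q =
        C c ^ q * X 0 ^ q - C a ^ q * X 2 ^ q := by
      rw [sub_eq_add_neg, hadd, hneg, mul_pow, mul_pow, sub_eq_add_neg]
    -- Expanding, the two sides differ by `z ^ (q + 1)` times the equation of the curve at `P`.
    have key : C c ^ (q + 1) * hermitianPoly q F =
        P.tangentForm * (C c ^ q * X 2 * P.tangentForm ^ (q - 1) + C c * X 2 ^ q) -
          (C c * X 0 - C a * X 2) ^ (q + 1) := by
      have h1 : P.tangentForm * (C c ^ q * X 2 * P.tangentForm ^ (q - 1) + C c * X 2 ^ q) =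
          C c ^ q * X 2 * P.tangentForm ^ q + C c * X 2 ^ q * P.tangentForm := by
        rw [← hTq]; ring
      rw [h1, hTpow, hT, pow_succ (C c * X 0 - C a * X 2), hlpow, hermitianPoly]
      simp only [C_pow]
      linear_combination -X 2 ^ (q + 1) * hPC
    have hcq : (C c⁻¹ : MvPolynomial (Fin 3) F) ^ (q + 1) * C c ^ (q + 1) = 1 := by
      rw [← mul_pow, hcC, one_pow]
    have hcq0 : c ^ (q + 1) ≠ 0 := pow_ne_zero _ hc0
    -- `v = (c ^ q, a ^ q, 0)` is where the tangent line meets `z = 0`. The factor `c⁻¹ ^ (q + 1)`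
    -- gives `l(v) = 1`, and `k` compensates for its `(q + 1)`-th power.
    refine ⟨C c⁻¹ * X 2, C c⁻¹ ^ (q + 1) * (C c * X 0 - C a * X 2),
      C c⁻¹ ^ (q + 1) * (C c ^ q * X 2 * P.tangentForm ^ (q - 1) + C c * X 2 ^ q),
      ![c ^ q, a ^ q, 0], ![0, c⁻¹ ^ q, 0], -(c ^ (q + 1)) ^ q, ?_, ?_, ?_, ?_, ?_, ?_, by simp, ?_,
      hTP, ?_, ?_⟩
    · rw [← C_pow]
      exact ((isHomogeneous_C_mul_X _ _).sub (isHomogeneous_C_mul_X _ _)).C_mul _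
    · intro i
      match i with
      | 0 =>
        simp only [ha, Matrix.cons_val, C_0, C_pow]
        linear_combination -X 0 * hcq + C a * C c⁻¹ * X 2 * hcC'
      | 1 =>
        simp only [hb, hT, Matrix.cons_val, C_pow]
        linear_combination -X 1 * hcC' - C a ^ q * C c⁻¹ ^ q * X 0 * hcC + X 2 *
          (-C c⁻¹ * C c⁻¹ ^ q * hPC + C c⁻¹ ^ q * C b ^ q * hcC + C b * C c⁻¹ * hcC')
      | 2 =>
        simp only [hc, Matrix.cons_val, C_0]
        linear_combination -X 2 * hcC
    · have h2 : (C ((c ^ (q + 1)) ^ q) * (C c⁻¹ ^ (q + 1) * (C c * X 0 - C a * X 2)) ^ (q + 1) :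
          MvPolynomial (Fin 3) F) = C c⁻¹ ^ (q + 1) * (C c * X 0 - C a * X 2) ^ (q + 1) := by
        rw [mul_pow, ← mul_assoc, pow_succ (C c⁻¹ ^ (q + 1)) q, ← mul_assoc, C_pow, C_pow, ← mul_pow,
          mul_comm (C c ^ (q + 1)), hcq, one_pow, one_mul]
      rw [C_neg, neg_mul, h2]
      linear_combination (-hermitianPoly q F) * hcq + C c⁻¹ ^ (q + 1) * key
    · exact neg_ne_zero.mpr (pow_ne_zero _ hcq0)
    · have : q - 1 ≠ 0 := by omega
      simp [hc, hTP, this, hc0]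
    · simp [ha, hc, mul_comm]
    · simp only [map_mul, map_pow, map_sub, eval_C, eval_X, Matrix.cons_val]
      have h2 : c⁻¹ ^ (q + 1) * c ^ (q + 1) = 1 := by rw [← mul_pow, inv_mul_cancel₀ hc0, one_pow]
      linear_combination h2
    · rw [hT]; simp [mul_comm]
    · intro h0
      have := congrArg (eval ![0, 1, 0]) (hT.symm.trans h0)
      simp [hc0] at this

end HermitianCode

end

/-! ### Restriction to the tangent line and division by its equation -/

noncomputable section

namespace HermitianCode

open MvPolynomial

variable {q : ℕ} {F : Type*} [Field F]

namespace Point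

lemma isHomogeneous_tangentForm (P : Point q F) : P.tangentForm.IsHomogeneous 1 :=
  IsHomogeneous.sum _ _ _ fun _ _ => isHomogeneous_C_mul_X _ _

lemma ext_of_smul {P Q : Point q F} (c : F) (h : ∀ i, Q.vec i = c * P.vec i) : P = Q := by
  apply Subtype.ext
  rw [← P.1.mk_rep, ← Q.1.mk_rep, eq_comm, Projectivization.mk_eq_mk_iff']
  exact ⟨c, funext fun i => (h i).symm⟩

end Point

/-- The restriction of polynomials to the plane spanned by `P` and `v`. -/
def restrictPlane (P : Point q F) (v : Fin 3 → F) :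
    MvPolynomial (Fin 3) F →ₐ[F] MvPolynomial (Fin 2) F :=
  aeval fun i => C (P.vec i) * X 1 + C (v i) * X 0

/-- The restriction of polynomials to the affine line through `P` in the direction `v`. -/
def restrictLine (P : Point q F) (v : Fin 3 → F) : MvPolynomial (Fin 3) F →ₐ[F] Polynomial F :=
  (aeval ![Polynomial.X, 1]).comp (restrictPlane P v)

lemma eval_restrictLine (P : Point q F) (v : Fin 3 → F) (f : MvPolynomial (Fin 3) F) :
    (restrictLine P v f).eval 0 = eval P.vec f := by
  have : (Polynomial.aeval (0 : F)).comp (restrictLine P v) = aeval P.vec := by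
    ext i
    simp [restrictLine, restrictPlane]
  have := congrArg (fun φ => φ f) this
  simpa [aeval_eq_eval, Polynomial.coe_aeval_eq_eval] using this

lemma eval_restrictPlane (P : Point q F) (v : Fin 3 → F) (f : MvPolynomial (Fin 3) F) :
    eval ![1, 0] (restrictPlane P v f) = eval v f := by
  have : (aeval ![(1 : F), 0]).comp (restrictPlane P v) = aeval v := by
    ext i
    simp [restrictPlane]
  have := congrArg (fun φ => φ f) this
  simpa [aeval_eq_eval] using this

lemma isHomogeneous_restrictPlane (P : Point q F) (v : Fin 3 → F) {f : MvPolynomial (Fin 3) F}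
    {d : ℕ} (hf : f.IsHomogeneous d) : (restrictPlane P v f).IsHomogeneous d := by
  have := hf.aeval (fun i => C (P.vec i) * X 1 + C (v i) * X 0 : Fin 3 → MvPolynomial (Fin 2) F)
    (n := 1) fun i => (isHomogeneous_C_mul_X _ _).add (isHomogeneous_C_mul_X _ _)
  rwa [one_mul] at this

lemma natDegree_restrictLine_le (P : Point q F) (v : Fin 3 → F) {f : MvPolynomial (Fin 3) F}
    {d : ℕ} (hf : f.IsHomogeneous d) : (restrictLine P v f).natDegree ≤ d := by
  have h := aeval_natDegree_le (R := F) (restrictPlane P v f)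
    (isHomogeneous_restrictPlane P v hf).totalDegree_le ![Polynomial.X, 1] (n := 1) (by
      intro i
      fin_cases i <;> simp)
  simpa [restrictLine] using h

lemma restrictPlane_eq_zero (P : Point q F) (v : Fin 3 → F) {f : MvPolynomial (Fin 3) F}
    {d : ℕ} (hf : f.IsHomogeneous d) (h : restrictLine P v f = 0) : restrictPlane P v f = 0 := by
  rw [← Polynomial.homogenize_eq_of_isHomogeneous (isHomogeneous_restrictPlane P v hf) h,
    Polynomial.homogenize_zero]

lemma X_pow_dvd_restrictLine {P : Point q F} {v : Fin 3 → F} {a : ℕ}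
    (hh : Polynomial.X ^ a ∣ restrictLine P v (hermitianPoly q F))
    {f : MvPolynomial (Fin 3) F} (hf : cls q f ∈ P.ideal ^ a) :
    Polynomial.X ^ a ∣ restrictLine P v f := by
  let π := Ideal.Quotient.mk (Ideal.span {(Polynomial.X ^ a : Polynomial F)})
  let φ : CoordRing q F →+* Polynomial F ⧸ Ideal.span {(Polynomial.X ^ a : Polynomial F)} :=
    Ideal.Quotient.lift _ (π.comp (restrictLine P v).toRingHom) (by
      intro p hp
      obtain ⟨w, rfl⟩ := Ideal.mem_span_singleton.mp hp
      refine Ideal.Quotient.eq_zero_iff_mem.mpr (Ideal.mem_span_singleton.mpr ?_)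
      exact (map_mul (restrictLine P v) _ _).symm ▸ hh.mul_right _)
  have hφ : ∀ p, φ (cls q p) = π (restrictLine P v p) := fun p => rfl
  have h1 : P.ideal ≤ Ideal.comap φ (Ideal.map π (Ideal.span {Polynomial.X})) := by
    refine Ideal.span_le.mpr ?_
    rintro g ⟨-, hg⟩
    obtain ⟨p, rfl⟩ := Ideal.Quotient.mk_surjective g
    refine Ideal.mem_comap.mpr (Ideal.mem_map_of_mem π (Ideal.mem_span_singleton.mpr ?_))
    rw [P.evalHom_cls] at hg
    rw [AlgHom.toRingHom_eq_coe, RingHom.coe_coe, Polynomial.X_dvd_iff,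
      Polynomial.coeff_zero_eq_eval_zero, eval_restrictLine, hg]
  have h2 := Ideal.le_comap_pow φ a (Ideal.pow_right_mono h1 a hf)
  rw [Ideal.mem_comap, ← Ideal.map_pow, Ideal.span_singleton_pow, Ideal.map_quotient_self,
    Ideal.mem_bot, hφ] at h2
  exact Ideal.mem_span_singleton.mp (Ideal.Quotient.eq_zero_iff_mem.mp h2)

namespace IsTangentFrame

variable {P : Point q F} {n l U : MvPolynomial (Fin 3) F} {v w : Fin 3 → F} {k : F}

lemma restrictPlane_tangentForm (h : IsTangentFrame P n l U v w k) :
    restrictPlane P v P.tangentForm = 0 := by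
  have h1 := congrArg (C (σ := Fin 2)) h.eval_tangentForm
  have h2 := congrArg (C (σ := Fin 2)) h.eval_tangentForm_v
  simp only [Point.tangentForm, map_sum, map_mul, eval_C, eval_X, C_0] at h1 h2
  simp only [Point.tangentForm, restrictPlane, map_sum, map_mul, algHom_C, aeval_X, mul_add,
    Finset.sum_add_distrib, ← mul_assoc, ← Finset.sum_mul, algebraMap_eq]
  rw [h1, h2, zero_mul, zero_mul, add_zero]

/-- Modulo `T` the coordinates are `P i * n + v i * l`, so `f` is congruent to its restriction
evaluated at `(l, n)`. -/
lemma dvd_of_restrictPlane_eq_zero (h : IsTangentFrame P n l U v w k)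
    {f : MvPolynomial (Fin 3) F} (hf : restrictPlane P v f = 0) : P.tangentForm ∣ f := by
  have h1 : aeval X f - aeval (fun i => C (P.vec i) * n + C (v i) * l) f ∈
      Ideal.span {P.tangentForm} := by
    refine aeval_sub_aeval_mem _ (fun i => ?_) f
    rw [Ideal.mem_span_singleton, h.X_eq i, add_sub_cancel_left]
    exact dvd_mul_left _ _
  have h2 : (aeval ![l, n]).comp (restrictPlane P v) =
      aeval (fun i => C (P.vec i) * n + C (v i) * l) := by
    ext i
    simp [restrictPlane, ← algebraMap_eq]
  rw [← h2, AlgHom.comp_apply, hf, map_zero, sub_zero, aeval_X_left_apply] at h1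
  exact Ideal.mem_span_singleton.mp h1

lemma restrictPlane_hermitianPoly_ne_zero (h : IsTangentFrame P n l U v w k) :
    restrictPlane P v (hermitianPoly q F) ≠ 0 := by
  intro h0
  have h1 := eval_restrictPlane P v (hermitianPoly q F)
  rw [h0, h.hermitianPoly_eq] at h1
  simp only [map_zero, map_add, map_mul, map_pow, eval_C, h.eval_tangentForm_v, h.eval_l_v] at h1
  exact h.k_ne_zero (by simpa using h1.symm)

/-- The restriction of `h` to `T = 0` is non-zero, so in a relation `T g = h r` the factor `T` must
divide `r`. -/
lemma eq_zero_of_tangentForm_mul (h : IsTangentFrame P n l U v w k) {u : CoordRing q F}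
    (hu : cls q P.tangentForm * u = 0) : u = 0 := by
  obtain ⟨g, rfl⟩ := Ideal.Quotient.mk_surjective u
  rw [cls, ← map_mul] at hu
  obtain ⟨r, hr⟩ := cls_eq_zero_iff.mp hu
  have h1 := congrArg (restrictPlane P v) hr
  rw [map_mul, map_mul, h.restrictPlane_tangentForm, zero_mul, eq_comm] at h1
  obtain ⟨r', rfl⟩ := h.dvd_of_restrictPlane_eq_zero
    ((mul_eq_zero.mp h1).resolve_left h.restrictPlane_hermitianPoly_ne_zero)
  refine cls_eq_zero_iff.mpr ⟨r', mul_left_cancel₀ h.tangentForm_ne_zero ?_⟩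
  rw [hr]; ring

lemma X_pow_dvd_restrictLine_hermitianPoly (h : IsTangentFrame P n l U v w k) :
    Polynomial.X ^ (q + 1) ∣ restrictLine P v (hermitianPoly q F) := by
  have h1 : restrictLine P v P.tangentForm = 0 := by
    rw [restrictLine, AlgHom.comp_apply, h.restrictPlane_tangentForm, map_zero]
  rw [h.hermitianPoly_eq, map_add, map_mul, map_mul, map_pow, h1, zero_mul, zero_add]
  refine Dvd.dvd.mul_left (pow_dvd_pow_of_dvd ?_ _) _
  rw [Polynomial.X_dvd_iff, Polynomial.coeff_zero_eq_eval_zero, eval_restrictLine, h.eval_l]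

/-- A form whose order of vanishing at `P` exceeds its degree, and is only considered up to the
intersection multiplicity `q + 1`, is divisible by the equation of the tangent line. -/
lemma tangentForm_dvd (h : IsTangentFrame P n l U v w k) {d a : ℕ} (hda : d < a)
    (haq : a ≤ q + 1) {f : MvPolynomial (Fin 3) F} (hf : f.IsHomogeneous d) {g : CoordRing q F}
    (hg : P.evalHom g ≠ 0) (hgf : g * cls q f ∈ P.ideal ^ a) : P.tangentForm ∣ f := by
  obtain ⟨g, rfl⟩ := Ideal.Quotient.mk_surjective g
  rw [cls, ← map_mul] at hgf
  rw [P.evalHom_cls] at hg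
  have h1 := X_pow_dvd_restrictLine
    ((pow_dvd_pow _ haq).trans h.X_pow_dvd_restrictLine_hermitianPoly) hgf
  -- The denominator `g` is a unit at `P`, hence all the vanishing falls on `f`.
  have h2 : ¬ Polynomial.X ∣ restrictLine P v g := by
    rwa [Polynomial.X_dvd_iff, Polynomial.coeff_zero_eq_eval_zero, eval_restrictLine]
  rw [map_mul] at h1
  have h3 := Polynomial.prime_X.pow_dvd_of_dvd_mul_left a h2 h1
  refine h.dvd_of_restrictPlane_eq_zero (restrictPlane_eq_zero P v hf ?_)
  refine Polynomial.eq_zero_of_dvd_of_natDegree_lt h3 ?_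
  rw [Polynomial.natDegree_X_pow]
  exact (natDegree_restrictLine_le P v hf).trans_lt hda

/-- On the curve, `T = 0` forces `l = 0`, and the only point with `T = l = 0` is `P`. -/
lemma eval_tangentForm_ne_zero (h : IsTangentFrame P n l U v w k) {Q : Point q F} (hPQ : P ≠ Q) :
    eval Q.vec P.tangentForm ≠ 0 := by
  intro h0
  have h1 : eval Q.vec (hermitianPoly q F) = 0 := Q.2
  rw [h.hermitianPoly_eq] at h1
  simp only [map_add, map_mul, map_pow, eval_C, h0, zero_mul, zero_add] at h1
  have hl : eval Q.vec l = 0 :=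
    eq_zero_of_pow_eq_zero ((mul_eq_zero.mp h1).resolve_left h.k_ne_zero)
  refine hPQ (Point.ext_of_smul (eval Q.vec n) fun i => ?_)
  have h2 := congrArg (eval Q.vec) (h.X_eq i)
  simp only [map_add, map_mul, eval_C, eval_X, hl, h0] at h2
  rw [h2]; ring

/-- On the curve `U T = -k l ^ (q + 1)`; since `U` is a unit at `P`, this says that `T` vanishes
there to order at least `q + 1`. -/
lemma cls_U_mul_tangentForm_mem (h : IsTangentFrame P n l U v w k) :
    cls q U * cls q P.tangentForm ∈ P.ideal ^ (q + 1) := by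
  have hl : cls q l ∈ P.ideal :=
    Ideal.subset_span ⟨⟨1, mem_homogPart_iff.mpr ⟨l, h.isHomogeneous_l, rfl⟩⟩,
      by rw [P.evalHom_cls, h.eval_l]⟩
  have h1 : cls q (P.tangentForm * U + C k * l ^ (q + 1)) = 0 :=
    cls_eq_zero_iff.mpr h.hermitianPoly_eq.dvd
  simp only [cls, map_add, map_mul, map_pow] at h1
  have h2 : cls q U * cls q P.tangentForm = -cls q (C k) * cls q l ^ (q + 1) := by
    linear_combination h1
  rw [h2]
  exact Ideal.mul_mem_left _ _ (Ideal.pow_mem_pow hl _)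

/-- Multiplication by the equation of the tangent line at `P`. -/
lemma bijOn_sections (h : IsTangentFrame P n l U v w k) (hq : 0 < q) {d a : ℕ} (hda : d + 1 < a)
    (haq : a ≤ q + 1) {E : Point q F →₀ ℕ} (hE : E P = 0) :
    Set.BijOn (fun t : Cochain q F => toCochain (cls q P.tangentForm) * t)
      (sections d E) (sections (d + 1) (E + Finsupp.single P a)) := by
  refine ⟨?_, ?_, ?_⟩
  · intro t ht
    obtain ⟨f, hf, hfE, rfl⟩ := (mem_sections_iff hq).mp ht
    refine (mem_sections_iff hq).mpr ⟨P.tangentForm * f, ?_, fun Q => ?_, ?_⟩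
    · rw [add_comm]
      exact P.isHomogeneous_tangentForm.mul hf
    · by_cases hPQ : P = Q
      · subst hPQ
        refine ⟨cls q U, by rw [P.evalHom_cls]; exact h.eval_U, ?_⟩
        rw [Finsupp.add_apply, hE, zero_add, Finsupp.single_eq_same, cls_mul, ← mul_assoc]
        exact Ideal.mul_mem_right _ _ (Ideal.pow_le_pow_right haq h.cls_U_mul_tangentForm_mem)
      · obtain ⟨g, hg, hgf⟩ := hfE Q
        refine ⟨g, hg, ?_⟩
        rw [Finsupp.add_apply, Finsupp.single_eq_of_ne' hPQ, add_zero, cls_mul, mul_left_comm]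
        exact Ideal.mul_mem_left _ _ hgf
    · rw [cls_mul, map_mul]
  · intro t ht t' ht' htt
    obtain ⟨f, -, -, rfl⟩ := (mem_sections_iff hq).mp ht
    obtain ⟨f', -, -, rfl⟩ := (mem_sections_iff hq).mp ht'
    simp only [← map_mul] at htt
    have h1 := toCochain_injective hq htt
    exact congrArg _ (sub_eq_zero.mp (h.eq_zero_of_tangentForm_mul
      (by rw [mul_sub, sub_eq_zero]; exact h1)))
  · intro t ht
    obtain ⟨f, hf, hfE, rfl⟩ := (mem_sections_iff hq).mp ht
    obtain ⟨g, hg, hgf⟩ := hfE P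
    rw [Finsupp.add_apply, hE, zero_add, Finsupp.single_eq_same] at hgf
    obtain ⟨f', rfl⟩ := h.tangentForm_dvd hda haq hf hg hgf
    -- The quotient `f'` is not known to be homogeneous; comparing components of degree `d + 1`
    -- shows that it equals its own part of degree `d`.
    have h1 : P.tangentForm * homogeneousComponent d f' = P.tangentForm * f' := by
      rw [← homogeneousComponent_add_mul P.isHomogeneous_tangentForm, add_comm 1 d,
        homogeneousComponent_eq_self hf]
    rw [mul_left_cancel₀ h.tangentForm_ne_zero h1.symm] at hfE ⊢
    refine ⟨toCochain (cls q (homogeneousComponent d f')), (mem_sections_iff hq).mpr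
      ⟨_, homogeneousComponent_isHomogeneous d f', fun Q => ?_, rfl⟩, ?_⟩
    · by_cases hPQ : P = Q
      · subst hPQ
        exact ⟨1, by simp, by simp [hE]⟩
      · obtain ⟨g, hg, hgf⟩ := hfE Q
        rw [Finsupp.add_apply, Finsupp.single_eq_of_ne' hPQ, add_zero, cls_mul,
          ← mul_assoc] at hgf
        refine ⟨_, ?_, hgf⟩
        rw [map_mul]
        exact mul_ne_zero hg (by
          rw [Q.evalHom_cls]; exact h.eval_tangentForm_ne_zero hPQ)
    · exact (by rw [cls_mul, map_mul] : _ = _).symm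

end IsTangentFrame

end HermitianCode

end

/-! ### Codes, iteration over the points, and the main theorem -/

noncomputable section

namespace HermitianCode

open MvPolynomial

section Codes

variable {F ι : Type*} [Field F]

/-- Multiplication by `w` is self-adjoint for the dot product, so the duals correspond under `w⁻¹`.
-/
lemma StronglyIsometric.dualCode [Fintype ι] {C D : Submodule F (ι → F)}
    (h : StronglyIsometric C D) : StronglyIsometric (dualCode C) (dualCode D) := by
  obtain ⟨w, hw, hCD⟩ := h
  have hdot : ∀ u c : ι → F, u ⬝ᵥ (w * c) = (w * u) ⬝ᵥ c := fun u c => by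
    simp only [dotProduct, Pi.mul_apply]
    exact Finset.sum_congr rfl fun i _ => by ring
  have hinv : ∀ u : ι → F, w * (w⁻¹ * u) = u := fun u => by
    funext i
    simp [hw i]
  have hC : ∀ u, u ∈ HermitianCode.dualCode C ↔ w * u ∈ HermitianCode.dualCode D := by
    intro u
    constructor
    · intro hu c hc
      rw [← hdot]
      exact hu _ (hCD.symm.subset ⟨c, hc, rfl⟩)
    · intro hu v hv
      obtain ⟨c, hc, rfl⟩ := hCD.subset hv
      change u ⬝ᵥ (w * c) = 0
      rw [hdot]
      exact hu c hc
  refine ⟨w⁻¹, fun i => inv_ne_zero (hw i), Set.ext fun u => ?_⟩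
  constructor
  · intro hu
    refine ⟨w * u, (hC u).mp hu, ?_⟩
    change w⁻¹ * (w * u) = u
    rw [mul_left_comm, hinv]
  · rintro ⟨c, hc, rfl⟩
    exact (hC _).mpr (by rw [hinv]; exact hc)

end Codes

variable {q : ℕ} {F : Type*} [Field F]

lemma Point.evalAt_toCochain_mul (P : Point q F) (g : CoordRing q F) (t : Cochain q F) :
    P.evalAt (toCochain g * t) = P.evalHom g * P.evalAt t := by
  change P.chartEval _ P.exists_vec_ne_zero.choose_spec ((toCochain g * t) _) = _
  rw [Pi.mul_apply, map_mul, P.chartEval_toCochain]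
  rfl

lemma code_eq_image {d d' : ℕ} {E E' : Point q F →₀ ℕ} {L : MvPolynomial (Fin 3) F}
    (h : (fun t : Cochain q F => toCochain (cls q L) * t) '' (sections d' E') = sections d E)
    (B : Finset (Point q F)) :
    (code B d E : Set (B → F)) =
      (fun c : B → F => fun Q => eval Q.1.vec L * c Q) '' (code B d' E' : Set (B → F)) := by
  simp only [code, Submodule.map_coe, ← h, Set.image_image]
  refine Set.image_congr fun t _ => funext fun Q => ?_
  simp only [LinearMap.pi_apply, Point.evalAt_toCochain_mul, Point.evalHom_cls]

section FiniteField

variable [Finite F]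

lemma exists_isTangentFrame_of_card (hq : IsPrimePow q) (hF : Nat.card F = q ^ 2)
    (P : Point q F) : ∃ n l U v w k, IsTangentFrame P n l U v w k := by
  have h2 : 2 ≤ q := hq.two_le
  have := Fintype.ofFinite F
  rw [Nat.card_eq_fintype_card] at hF
  have hq0 : (q : F) = 0 := by
    have h : ((Fintype.card F : ℕ) : F) = 0 := Nat.cast_card_eq_zero F
    rw [hF, Nat.cast_pow] at h
    exact eq_zero_of_pow_eq_zero h
  obtain ⟨p, k, hp, -, rfl⟩ := hq
  have : Fact p.Prime := ⟨hp.nat_prime⟩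
  have hp0 : (p : F) = 0 := eq_zero_of_pow_eq_zero (by rwa [Nat.cast_pow] at hq0)
  have : CharP F p := ringChar.of_eq (CharP.ringChar_of_prime_eq_zero hp.nat_prime hp0)
  refine exists_isTangentFrame h2 hq0 (fun f g => add_pow_char_pow f g p k) (fun c => ?_) P
  rw [← pow_mul, ← sq, ← hF, FiniteField.pow_card]

lemma bijOn_prod_tangentForm (hq : IsPrimePow q) (hF : Nat.card F = q ^ 2) {d r m : ℕ}
    {a : ℕ → ℕ} {P : ℕ → Point q F} (hP : Set.InjOn P (Set.Icc 1 (r + m)))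
    (ha : ∀ i < m, d + i + 1 < a (r + i + 1) ∧ a (r + i + 1) ≤ q + 1) :
    Set.BijOn (fun t : Cochain q F =>
        toCochain (cls q (∏ i ∈ Finset.Ioc r (r + m), (P i).tangentForm)) * t)
      (sections d (∑ i ∈ Finset.Icc 1 r, Finsupp.single (P i) (a i)))
      (sections (d + m) (∑ i ∈ Finset.Icc 1 (r + m), Finsupp.single (P i) (a i))) := by
  induction m with
  | zero =>
    have h1 : ∀ t : Cochain q F, toCochain (cls q (1 : MvPolynomial (Fin 3) F)) * t = t :=
      fun t => by rw [cls, map_one, map_one, one_mul]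
    simpa only [add_zero, Finset.Ioc_self, Finset.prod_empty, h1] using! Set.bijOn_id _
  | succ m ih =>
    have ih' := ih (hP.mono (Set.Icc_subset_Icc_right (by omega))) fun i hi => ha i (by omega)
    obtain ⟨n, l, U, v, w, k, hframe⟩ := exists_isTangentFrame_of_card hq hF (P (r + m + 1))
    obtain ⟨h1, h2⟩ := ha m (Nat.lt_succ_self m)
    have hE : (∑ i ∈ Finset.Icc 1 (r + m), Finsupp.single (P i) (a i)) (P (r + m + 1)) = 0 := by
      rw [Finsupp.finsetSum_apply]
      refine Finset.sum_eq_zero fun i hi => Finsupp.single_eq_of_ne' fun h => ?_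
      rw [Finset.mem_Icc] at hi
      have := hP (Set.mem_Icc.mpr ⟨hi.1, by omega⟩) (Set.mem_Icc.mpr ⟨by omega, le_rfl⟩) h
      omega
    -- The tangent at the last point is multiplied in last, when the degree is already `d + m`; this
    -- is why the lower bound on `a` grows with the index.
    have hcomp := (hframe.bijOn_sections hq.pos h1 h2 hE).comp ih'
    rw [← add_assoc, Finset.sum_Icc_succ_top (by omega), ← add_assoc,
      Finset.prod_Ioc_succ_top (by omega)]
    refine hcomp.congr fun t _ => ?_
    simp only [Function.comp_apply, map_mul]
    ring

end FiniteField

end HermitianCode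

end

theorem lemmau4 {F : Type*} [Field F] [Finite F] (q : ℕ) (hq : IsPrimePow q)
    (hF : Nat.card F = q ^ 2) (d s : ℕ) (hd : 0 < d) (hs : 1 ≤ s)
    (a : ℕ → ℕ) (ha : ∀ i ∈ Finset.Icc 1 s, 1 ≤ a i ∧ a i ≤ q + 1)
    (hmono : MonotoneOn a (Set.Icc 1 s))
    (r : ℕ)
    (hr : IsGreatest {i : ℕ | i ≤ s ∧ (1 ≤ i → (a i : ℤ) ≤ (d : ℤ) - s + i)} r)
    (d' : ℕ) (hd' : (d' : ℤ) = (d : ℤ) - s + r) (hd'pos : 0 < d')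
    (P : ℕ → HermitianCode.Point q F) (hP : Set.InjOn P (Set.Icc 1 s))
    (E E' : HermitianCode.Point q F →₀ ℕ)
    (hE : E = ∑ i ∈ Finset.Icc 1 s, Finsupp.single (P i) (a i))
    (hE' : E' = ∑ i ∈ Finset.Icc 1 r, Finsupp.single (P i) (a i))
    (L : MvPolynomial (Fin 3) F)
    (hL : L = ∏ i ∈ Finset.Ioc r s, (P i).tangentForm)
    (B : Finset (HermitianCode.Point q F)) (hB : ∀ i ∈ Finset.Icc 1 s, P i ∉ B) :
    -- multiplication by the equations of the tangent lines is a bijection, whose inverse is the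
    -- division by these equations
    Set.BijOn (fun t : HermitianCode.Cochain q F =>
      HermitianCode.toCochain (HermitianCode.cls q L) * t)
      (HermitianCode.sections d' E') (HermitianCode.sections d E) ∧
    -- it induces the strong isometry of the codes
    (∀ Q ∈ B, MvPolynomial.eval Q.vec L ≠ 0) ∧
    (HermitianCode.code B d E : Set (B → F)) =
      (fun c : B → F => fun Q => MvPolynomial.eval Q.1.vec L * c Q) ''
        (HermitianCode.code B d' E' : Set (B → F)) ∧
    HermitianCode.StronglyIsometric (HermitianCode.code B d E) (HermitianCode.code B d' E') ∧
    HermitianCode.StronglyIsometric (HermitianCode.dualCode (HermitianCode.code B d E))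
      (HermitianCode.dualCode (HermitianCode.code B d' E')) := by
  obtain ⟨⟨hrs, -⟩, hmax⟩ := hr
  obtain ⟨m, rfl⟩ := Nat.exists_eq_add_of_le hrs
  obtain rfl : d = d' + m := by push_cast at hd'; omega
  have hlt : ∀ i < m, d' + i + 1 < a (r + i + 1) ∧ a (r + i + 1) ≤ q + 1 := by
    intro i hi
    refine ⟨?_, (ha _ (Finset.mem_Icc.mpr ⟨by omega, by omega⟩)).2⟩
    by_contra hle
    -- With `s = r + m` and `d = d' + m`, the bound `d - s + (r + i + 1)` equals `d' + i + 1`, so a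
    -- failure would contradict the maximality of `r`.
    have : r + i + 1 ≤ r := hmax ⟨by omega, fun _ => by push_cast; omega⟩
    omega
  have hbij : Set.BijOn (fun t : HermitianCode.Cochain q F =>
      HermitianCode.toCochain (HermitianCode.cls q L) * t)
      (HermitianCode.sections d' E') (HermitianCode.sections (d' + m) E) := by
    rw [hL, hE, hE']
    exact HermitianCode.bijOn_prod_tangentForm hq hF hP hlt
  have hne : ∀ Q ∈ B, MvPolynomial.eval Q.vec L ≠ 0 := by
    intro Q hQ
    rw [hL, map_prod]
    refine Finset.prod_ne_zero_iff.mpr fun i hi => ?_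
    rw [Finset.mem_Ioc] at hi
    obtain ⟨n, l, U, v, w, k, hframe⟩ := HermitianCode.exists_isTangentFrame_of_card hq hF (P i)
    refine hframe.eval_tangentForm_ne_zero ?_
    rintro rfl
    exact hB i (Finset.mem_Icc.mpr ⟨by omega, hi.2⟩) hQ
  have hcode := HermitianCode.code_eq_image hbij.image_eq B
  have hiso : HermitianCode.StronglyIsometric (HermitianCode.code B (d' + m) E)
      (HermitianCode.code B d' E') :=
    ⟨fun Q => MvPolynomial.eval Q.1.vec L, fun Q => hne Q.1 Q.2, hcode⟩
  exact ⟨hbij, hne, hcode, hiso, hiso.dualCode⟩
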